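/- Let $n\ge 1$, let $U\subset\mathbb R^{2n}$ be an open unit disk (a Euclidean open ball of radius $1$, with arbitrary centre), and let $\omega=\sum_{i=1}^n dx^i\wedge dx^{i+n}$ be the canonical symplectic form. Let $\Omega^k(U)$ be the space of smooth real $k$-forms on $U$, let $L A=\omega\wedge A$, and let $\Lambda A=\tfrac12\sum_{i,j}(\omega^{-1})^{ij}\,\iota_{\partial_{x^i}}\iota_{\partial_{x^j}}A$. Let $\mathcal P^k(U)=\{B\in\Omega^k(U):\Lambda B=0\}$ be the space of primitive $k$-forms, with $\mathcal P^k(U)=0$ for $k<0$. For $0\le k\le n$, each $B\in\mathcal P^k(U)$ satisfies $dB=B^0+L B^1$ for unique $B^0\in\mathcal P^{k+1}(U)$ and $B^1\in\mathcal P^{k-1}(U)$ (with $B^0=0$ if $k=n$), and $\partial_+B:=B^0$. For $0\le k<n$ let $$PH^k_{\partial_+}(U)=\frac{\ker\partial_+\cap\mathcal P^k(U)}{\partial_+\mathcal P^{k-1}(U)} .$$ Then: 1. $\dim_{\mathbb R} PH^0_{\partial_+}(U)=1$; 2. if $n\ge 2$, then $\dim_{\mathbb R} PH^1_{\partial_+}(U)=1$,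 and the tautological one-form $\theta=\sum_{i=1}^n x^{i+n}\,dx^i$ is a $\partial_+$-closed primitive form whose class in $PH^1_{\partial_+}(U)$ is nonzero; 3. $PH^k_{\partial_+}(U)=0$ for $2\le k<n$. -/

import Mathlib

open scoped ContDiff

noncomputable section

namespace PrimCoh

/-- `ℝ²ⁿ` with its Euclidean norm.  The coordinates are `x¹, …, xⁿ` (indices `Fin.castAdd n i`)
followed by `xⁿ⁺¹, …, x²ⁿ` (indices `Fin.natAdd n i`). -/
abbrev Space (n : ℕ) : Type := EuclideanSpace ℝ (Fin (n + n))

/-- Alternating `k`-linear forms on `ℝ²ⁿ`. -/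
abbrev Alt (n k : ℕ) : Type := Space n [⋀^Fin k]→L[ℝ] ℝ

/-- The open unit disk of `ℝ²ⁿ` with centre `c`. -/
def disk {n : ℕ} (c : Space n) : TopologicalSpace.Opens (Space n) :=
  ⟨Metric.ball c 1, Metric.isOpen_ball⟩

/-- The coordinate covector `dxʲ`. -/
def dx {n : ℕ} (j : Fin (n + n)) : Space n →L[ℝ] ℝ := EuclideanSpace.proj j

/-- The coordinate vector `∂/∂xʲ`. -/
def ex {n : ℕ} (j : Fin (n + n)) : Space n := EuclideanSpace.single j 1

/-! ### Pointwise operators -/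

/-- Exterior multiplication `A ↦ f ∧ A` by a covector `f`:
`(f ∧ A)(v₀, …, v_k) = ∑ i, (-1)ⁱ f(vᵢ) A(v₀, …, v̂ᵢ, …, v_k)`. -/
def wedge {n : ℕ} (k : ℕ) (f : Space n →L[ℝ] ℝ) : Alt n k →L[ℝ] Alt n (k + 1) :=
  (ContinuousAlternatingMap.alternatizeUncurryFinCLM ℝ (Space n) ℝ).comp
    (ContinuousLinearMap.smulRightL ℝ (Space n) (Alt n k) f)

theorem wedge_apply {n k : ℕ} (f : Space n →L[ℝ] ℝ) (A : Alt n k) (v : Fin (k + 1) → Space n) :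
    wedge k f A v = ∑ i : Fin (k + 1), (-1 : ℝ) ^ (i : ℕ) * (f (v i) * A (i.removeNth v)) := by
  have h : wedge k f A
      = ContinuousAlternatingMap.alternatizeUncurryFin (f.smulRight A) := rfl
  rw [h, ContinuousAlternatingMap.alternatizeUncurryFin_apply]
  simp [zsmul_eq_mul]

/-- The Lefschetz operator `L A = ω ∧ A` of the canonical symplectic form
`ω = ∑ i, dxⁱ ∧ dxⁱ⁺ⁿ`, that is `L A = ∑ i, dxⁱ ∧ (dxⁱ⁺ⁿ ∧ A)`. -/
def lef (n k : ℕ) : Alt n k →L[ℝ] Alt n (k + 2) :=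
  ∑ i : Fin n, (wedge (k + 1) (dx (Fin.castAdd n i))).comp (wedge k (dx (Fin.natAdd n i)))

/-- The dual Lefschetz operator `Λ A = ½ ∑ (ω⁻¹)ⁱʲ ι(∂ᵢ) ι(∂ⱼ) A`.  For the canonical form,
`(ω⁻¹)ⁱ⁺ⁿ'ⁱ = 1 = -(ω⁻¹)ⁱ'ⁱ⁺ⁿ` and all other entries vanish, so that
`Λ A = ∑ i, ι(∂ᵢ₊ₙ) ι(∂ᵢ) A`.  (On forms of degree `0` and `1` it is zero.) -/
def dualLef (n k : ℕ) : Alt n (k + 2) →ₗ[ℝ] Alt n k where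
  toFun A := ∑ i : Fin n, (A.curryLeft (ex (Fin.castAdd n i))).curryLeft (ex (Fin.natAdd n i))
  map_add' A B := by simp [Finset.sum_add_distrib]
  map_smul' c A := by simp [Finset.smul_sum]

/-- The primitive alternating forms: those with `Λ A = 0`.  All forms of degree `0` and `1` are
primitive. -/
def primAlt (n : ℕ) : (k : ℕ) → Submodule ℝ (Alt n k)
  | 0 => ⊤
  | 1 => ⊤
  | k + 2 => LinearMap.ker (dualLef n k)

/-! ### Smooth differential forms on an open set -/

/-- The smooth differential `k`-forms on the open set `U`, as functions on the whole space that
are smooth on `U` and vanish outside of `U`. -/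
def formSubmodule {n : ℕ} (U : TopologicalSpace.Opens (Space n)) (k : ℕ) :
    Submodule ℝ (Space n → Alt n k) where
  carrier := {α | ContDiffOn ℝ ∞ α U ∧ ∀ x, x ∉ U → α x = 0}
  add_mem' {α β} hα hβ := ⟨hα.1.add hβ.1, fun x hx => by simp [hα.2 x hx, hβ.2 x hx]⟩
  zero_mem' := ⟨contDiffOn_const, fun _ _ => rfl⟩
  smul_mem' c α hα := ⟨hα.1.const_smul c, fun x hx => by simp [hα.2 x hx]⟩

/-- `Ω^k(U)`, the real vector space of smooth differential `k`-forms on the open set `U`.  A form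
on `U` is represented by its extension by zero to the whole space, so two forms are equal iff they
agree on `U`. -/
def Form {n : ℕ} (U : TopologicalSpace.Opens (Space n)) (k : ℕ) : Type :=
  formSubmodule U k

instance {n : ℕ} (U : TopologicalSpace.Opens (Space n)) (k : ℕ) : AddCommGroup (Form U k) :=
  (formSubmodule U k).addCommGroup

instance {n : ℕ} (U : TopologicalSpace.Opens (Space n)) (k : ℕ) : Module ℝ (Form U k) :=
  (formSubmodule U k).module

/-- The value of a form at a point (zero outside of `U`). -/
def Form.at {n k : ℕ} {U : TopologicalSpace.Opens (Space n)} (α : Form U k) :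
    Space n → Alt n k :=
  Subtype.val (p := fun β => β ∈ formSubmodule U k) α

theorem Form.contDiffOn {n k : ℕ} {U : TopologicalSpace.Opens (Space n)} (α : Form U k) :
    ContDiffOn ℝ ∞ α.at U :=
  (Subtype.property (p := fun β => β ∈ formSubmodule U k) α).1

theorem Form.at_of_notMem {n k : ℕ} {U : TopologicalSpace.Opens (Space n)} (α : Form U k)
    {x : Space n} (hx : x ∉ U) : α.at x = 0 :=
  (Subtype.property (p := fun β => β ∈ formSubmodule U k) α).2 x hx

theorem Form.at_add {n k : ℕ} {U : TopologicalSpace.Opens (Space n)} (α β : Form U k) :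
    (α + β).at = α.at + β.at := rfl

theorem Form.at_smul {n k : ℕ} {U : TopologicalSpace.Opens (Space n)} (c : ℝ) (α : Form U k) :
    (c • α).at = c • α.at := rfl

theorem Form.at_zero {n k : ℕ} {U : TopologicalSpace.Opens (Space n)} :
    (0 : Form U k).at = 0 := rfl

theorem Form.ext {n k : ℕ} {U : TopologicalSpace.Opens (Space n)} {α β : Form U k}
    (h : ∀ x ∈ U, α.at x = β.at x) : α = β := by
  apply Subtype.ext (p := fun β => β ∈ formSubmodule U k)
  funext x
  by_cases hx : x ∈ U
  · exact h x hx
  · exact (α.at_of_notMem hx).trans (β.at_of_notMem hx).symm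

open Classical in
/-- The form on `U` given by the restriction to `U` of a function that is smooth on `U`. -/
def restrictForm {n k : ℕ} (U : TopologicalSpace.Opens (Space n)) (α : Space n → Alt n k)
    (hα : ContDiffOn ℝ ∞ α U) : Form U k :=
  ⟨fun x => if x ∈ U then α x else 0,
    hα.congr fun x hx => if_pos hx, fun x hx => if_neg hx⟩

theorem restrictForm_apply {n k : ℕ} {U : TopologicalSpace.Opens (Space n)}
    {α : Space n → Alt n k} (hα : ContDiffOn ℝ ∞ α U) {x : Space n} (hx : x ∈ U) :
    (restrictForm U α hα).at x = α x := if_pos hx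

theorem Form.differentiableAt {n k : ℕ} {U : TopologicalSpace.Opens (Space n)} (α : Form U k)
    {x : Space n} (hx : x ∈ U) : DifferentiableAt ℝ α.at x :=
  (α.contDiffOn.contDiffAt (U.isOpen.mem_nhds hx)).differentiableAt (by simp)

theorem contDiffOn_extDeriv {n k : ℕ} {U : TopologicalSpace.Opens (Space n)} (α : Form U k) :
    ContDiffOn ℝ ∞ (extDeriv α.at) U := by
  have h : ContDiffOn ℝ ∞ (fderiv ℝ α.at) U :=
    α.contDiffOn.fderiv_of_isOpen U.isOpen (by simp)
  exact (ContinuousAlternatingMap.alternatizeUncurryFinCLM ℝ (Space n) ℝ).contDiff.comp_contDiffOn h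

/-- The exterior derivative `d : Ω^k(U) → Ω^{k+1}(U)`. -/
def extD {n : ℕ} (U : TopologicalSpace.Opens (Space n)) (k : ℕ) : Form U k →ₗ[ℝ] Form U (k + 1) where
  toFun α := restrictForm U (extDeriv α.at) (contDiffOn_extDeriv α)
  map_add' α β := by
    apply Form.ext
    intro x hx
    simp only [Form.at_add, Pi.add_apply, restrictForm_apply _ hx]
    exact extDeriv_add (α.differentiableAt hx) (β.differentiableAt hx)
  map_smul' c α := by
    apply Form.ext
    intro x hx
    simp only [Form.at_smul, Pi.smul_apply, restrictForm_apply _ hx, RingHom.id_apply]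
    exact extDeriv_smul c α.at

/-- The Lefschetz operator `L : Ω^k(U) → Ω^{k+2}(U)`, `L A = ω ∧ A`. -/
def lefForm {n : ℕ} (U : TopologicalSpace.Opens (Space n)) (k : ℕ) :
    Form U k →ₗ[ℝ] Form U (k + 2) where
  toFun α := ⟨fun x => lef n k (α.at x),
    (lef n k).contDiff.comp_contDiffOn α.contDiffOn, fun x hx => by simp [α.at_of_notMem hx]⟩
  map_add' α β := Form.ext fun x _ => map_add (lef n k) (α.at x) (β.at x)
  map_smul' c α := Form.ext fun x _ => map_smul (lef n k) c (α.at x)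

/-- `P^k(U)`, the primitive `k`-forms on `U`: the smooth forms with `Λ B = 0`. -/
def Prim {n : ℕ} (U : TopologicalSpace.Opens (Space n)) (k : ℕ) : Submodule ℝ (Form U k) where
  carrier := {B | ∀ x ∈ U, B.at x ∈ primAlt n k}
  add_mem' hA hB x hx := (primAlt n k).add_mem (hA x hx) (hB x hx)
  zero_mem' _ _ := (primAlt n k).zero_mem
  smul_mem' c _ hA x hx := (primAlt n k).smul_mem c (hA x hx)

/-! ### The operator `∂₊` and its cohomology -/

/-- `L P^{k-1}(U) ⊆ Ω^{k+1}(U)`, which is zero for `k = 0`. -/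
def lefPrim {n : ℕ} (U : TopologicalSpace.Opens (Space n)) :
    (k : ℕ) → Submodule ℝ (Form U (k + 1))
  | 0 => ⊥
  | k + 1 => (Prim U k).map (lefForm U k)

/-- The graph of `∂₊ : P^k(U) → P^{k+1}(U)`.  By definition `∂₊ B = B⁰` means that
`d B = B⁰ + L B¹` with `B⁰ ∈ P^{k+1}(U)` and `B¹ ∈ P^{k-1}(U)`. -/
def dPlusGraph {n : ℕ} (U : TopologicalSpace.Opens (Space n)) (k : ℕ) :
    Submodule ℝ (Form U k × Form U (k + 1)) where
  carrier := {p | p.1 ∈ Prim U k ∧ p.2 ∈ Prim U (k + 1) ∧ extD U k p.1 - p.2 ∈ lefPrim U k}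
  add_mem' {p q} hp hq := by
    refine ⟨add_mem hp.1 hq.1, add_mem hp.2.1 hq.2.1, ?_⟩
    have h : extD U k (p + q).1 - (p + q).2
        = (extD U k p.1 - p.2) + (extD U k q.1 - q.2) := by
      rw [Prod.fst_add, Prod.snd_add, map_add]; abel
    rw [h]
    exact add_mem hp.2.2 hq.2.2
  zero_mem' := by
    refine ⟨zero_mem _, zero_mem _, ?_⟩
    simp
  smul_mem' c p hp := by
    refine ⟨Submodule.smul_mem _ c hp.1, Submodule.smul_mem _ c hp.2.1, ?_⟩
    have h : extD U k (c • p).1 - (c • p).2 = c • (extD U k p.1 - p.2) := by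
      rw [Prod.smul_fst, Prod.smul_snd, map_smul, smul_sub]
    rw [h]
    exact Submodule.smul_mem _ c hp.2.2

/-- `ker ∂₊ ∩ P^k(U)`. -/
def closed {n : ℕ} (U : TopologicalSpace.Opens (Space n)) (k : ℕ) : Submodule ℝ (Form U k) :=
  (dPlusGraph U k).comap (LinearMap.inl ℝ (Form U k) (Form U (k + 1)))

/-- `∂₊ P^{k-1}(U) ⊆ P^k(U)`, which is zero for `k = 0`. -/
def exact {n : ℕ} (U : TopologicalSpace.Opens (Space n)) : (k : ℕ) → Submodule ℝ (Form U k)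
  | 0 => ⊥
  | k + 1 => (dPlusGraph U k).map (LinearMap.snd ℝ (Form U k) (Form U (k + 1)))

/-- `∂₊`-exact forms inside the space of `∂₊`-closed primitive `k`-forms. -/
abbrev exactInClosed {n : ℕ} (U : TopologicalSpace.Opens (Space n)) (k : ℕ) :
    Submodule ℝ (closed U k) :=
  (exact U k).comap (closed U k).subtype

/-- The primitive cohomology `PH^k_{∂₊}(U) = (ker ∂₊ ∩ P^k(U)) / ∂₊ P^{k-1}(U)`. -/
abbrev PH {n : ℕ} (U : TopologicalSpace.Opens (Space n)) (k : ℕ) : Type :=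
  closed U k ⧸ exactInClosed U k

/-! ### The tautological one-form -/

/-- The coefficient function of the tautological one-form `θ = ∑ i, xⁱ⁺ⁿ dxⁱ`. -/
def tautFun (n : ℕ) (x : Space n) : Alt n 1 :=
  ∑ i : Fin n, x (Fin.natAdd n i) •
    ContinuousAlternatingMap.ofSubsingleton ℝ (Space n) ℝ (0 : Fin 1) (dx (Fin.castAdd n i))

theorem contDiff_tautFun (n : ℕ) : ContDiff ℝ ∞ (tautFun n) := by
  unfold tautFun
  refine ContDiff.sum fun i _ => ?_
  exact ContDiff.smul (f := fun x => dx (Fin.natAdd n i) x) (dx (Fin.natAdd n i)).contDiff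
    contDiff_const

/-- The tautological one-form `θ = ∑ i, xⁱ⁺ⁿ dxⁱ` on `U`, with `dθ = -ω`. -/
def taut {n : ℕ} (U : TopologicalSpace.Opens (Space n)) : Form U 1 :=
  restrictForm U (tautFun n) (contDiff_tautFun n).contDiffOn

end PrimCoh

end

open scoped ContDiff

noncomputable section

namespace PrimCoh

/-! ### Exterior algebra on a symplectic vector space -/

section

variable {n k : ℕ}

open ContinuousAlternatingMap (curryLeft_apply_apply curryLeft_same alternatizeUncurryFin
  alternatizeUncurryFinCLM alternatizeUncurryFinCLM_apply
  alternatizeUncurryFin_alternatizeUncurryFinCLM_comp_of_symmetric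
  alternatizeUncurryFin_curryLeft)

/-! Write `P^k` for primitive forms. Three facts suffice: `d` commutes with `L` since ω has constant
coefficients; `ΛL`, hence `L`, is injective on degrees below `n`, so a primitive form that lies in
`L Ω^k` with `k < n` is zero; closed forms of positive degree on a ball are exact.

Let α in `P^k` be ∂₊-closed with `1 ≤ k < n`, so `dα = Lβ`. Then `L dβ = ddα = 0`, hence `dβ = 0`.
If `k ≥ 2`, the Poincaré lemma gives `β = dγ`, so `α - Lγ` is closed and equals some `dδ`. Up to the
image of `L`, `dδ` is `dε` with ε primitive, and `dε` is `∂₊ε`. Thus `α - ∂₊ε` is primitive and lies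
in the image of `L`, so it vanishes (`mem_exact_of_mem_closed`).

If `k = 1`, β is a closed function, that is, a constant `r`, which need not be zero: this is the
only obstruction. Since `dθ = -ω`, the form `α + rθ` is closed, hence `df = ∂₊f` for some `f`. The
class of θ is nonzero because `dθ ≠ 0`. In degree 0 the closed forms are the constants.

Injectivity (`eq_zero_of_dualLef_lef_eq_zero`) comes from `[Λ, L] = n - k` alone: `ΛLA = 0` makes
`A` an eigenvector of `LΛ` with negative eigenvalue, and applying `Λ` repeatedly pushes such an
eigenvector down to degree 0 or 1. The Poincaré lemma (`exists_extD_eq`) is the radial homotopy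
integral. -/

theorem dx_apply (j : Fin (n + n)) (v : Space n) : dx j v = v j := rfl

theorem dx_ex (i j : Fin (n + n)) : dx i (ex j) = if i = j then 1 else 0 := by
  simp [dx_apply, ex]

theorem sum_smul_ex (v : Space n) : ∑ j, v j • ex j = v := by
  ext i
  simp [ex, Pi.single_apply]

/-- Contraction of an alternating form with a vector. -/
def contr (v : Space n) : Alt n (k + 1) →L[ℝ] Alt n k :=
  (ContinuousAlternatingMap.curryLeftLI (𝕜 := ℝ) (E := Space n) (F := ℝ)
    (n := k)).toContinuousLinearMap.flip v

theorem contr_eq_curryLeft (v : Space n) (A : Alt n (k + 1)) : contr v A = A.curryLeft v := rfl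

theorem contr_apply (v : Space n) (A : Alt n (k + 1)) (w : Fin k → Space n) :
    contr v A w = A (Matrix.vecCons v w) := rfl

theorem contr_add_left (v w : Space n) (A : Alt n (k + 1)) :
    contr (v + w) A = contr v A + contr w A := by
  simp [contr_eq_curryLeft]

theorem contr_wedge (f : Space n →L[ℝ] ℝ) (A : Alt n (k + 1)) (v : Space n) :
    contr v (wedge (k + 1) f A) = f v • A - wedge k f (contr v A) := by
  ext w
  rw [contr_apply, wedge_apply, Fin.sum_univ_succ, ContinuousAlternatingMap.sub_apply,
    wedge_apply, sub_eq_add_neg, ← Finset.sum_neg_distrib]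
  congr 1
  · simp [Fin.removeNth_zero]
  · refine Finset.sum_congr rfl fun i _ => ?_
    have h : i.succ.removeNth (Matrix.vecCons v w) = Matrix.vecCons v (i.removeNth w) := by
      funext j
      refine Fin.cases ?_ (fun j => ?_) j
      · simp [Fin.removeNth_apply]
      · simp [Fin.removeNth_apply]
    rw [h, contr_apply]
    simp [pow_succ]

theorem contr_wedge_zero (f : Space n →L[ℝ] ℝ) (A : Alt n 0) (v : Space n) :
    contr v (wedge 0 f A) = f v • A := by
  ext w
  rw [contr_apply, wedge_apply, Fin.sum_univ_succ]
  simp [Fin.removeNth_zero]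

/-- Polarization of the vanishing of a repeated contraction. -/
theorem contr_contr_comm (A : Alt n (k + 2)) (v w : Space n) :
    contr w (contr v A) = -contr v (contr w A) := by
  have h : ∀ u : Space n, contr u (contr u A) = 0 := curryLeft_same A
  have h' := h (v + w)
  rw [contr_add_left, contr_add_left, map_add, map_add, h, h, zero_add, add_zero] at h'
  exact eq_neg_of_add_eq_zero_right h'

/-- The double wedge alternates `f ⊗ f ⊗ A`, which is symmetric in its first two slots. -/
theorem wedge_wedge_self (f : Space n →L[ℝ] ℝ) (A : Alt n k) :
    wedge (k + 1) f (wedge k f A) = 0 := by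
  have h := alternatizeUncurryFin_alternatizeUncurryFinCLM_comp_of_symmetric
    (f := f.smulRight (f.smulRight A)) fun x y => by simp [smul_smul, mul_comm]
  refine Eq.trans ?_ h
  change alternatizeUncurryFin _ = _
  congr 1
  ext1 x
  simp only [ContinuousLinearMap.comp_apply, ContinuousLinearMap.smulRight_apply, map_smul]
  rfl

theorem wedge_add (f g : Space n →L[ℝ] ℝ) (A : Alt n k) :
    wedge k (f + g) A = wedge k f A + wedge k g A := by
  simp [wedge, map_add]

theorem wedge_wedge_comm (f g : Space n →L[ℝ] ℝ) (A : Alt n k) :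
    wedge (k + 1) f (wedge k g A) = -wedge (k + 1) g (wedge k f A) := by
  have h := wedge_wedge_self (f + g) A
  simp only [wedge_add, map_add, wedge_wedge_self, zero_add, add_zero] at h
  exact eq_neg_of_add_eq_zero_right h

/-- With `T` the derivative of a form this is `d = ∑ dxʲ ∧ ∂ⱼ`; it reduces identities for `d` to
identities for the wedge with a covector. -/
theorem alternatizeUncurryFin_eq_sum (T : Space n →L[ℝ] Alt n k) :
    alternatizeUncurryFin T = ∑ j, wedge k (dx j) (T (ex j)) := by
  have h : T = ∑ j, (dx j).smulRight (T (ex j)) := by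
    ext1 v
    conv_lhs => rw [← sum_smul_ex v]
    simp [_root_.map_sum, dx_apply]
  conv_lhs => rw [h]
  rw [← alternatizeUncurryFinCLM_apply, _root_.map_sum]
  rfl

/-- The degree operator. It supplies the degree in `[Λ, L]` and the factor `k + 1` in the homotopy
formula. -/
theorem sum_wedge_contr (A : Alt n (k + 1)) :
    ∑ j, wedge k (dx j) (contr (ex j) A) = ((k : ℝ) + 1) • A := by
  have h := alternatizeUncurryFin_eq_sum A.curryLeft
  rw [alternatizeUncurryFin_curryLeft] at h
  simp only [contr_eq_curryLeft]
  rw [← h]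
  ext v
  simp

theorem sum_wedge_contr_add (A : Alt n (k + 1)) :
    ∑ i, wedge k (dx (Fin.castAdd n i)) (contr (ex (Fin.castAdd n i)) A) +
      ∑ i, wedge k (dx (Fin.natAdd n i)) (contr (ex (Fin.natAdd n i)) A)
      = ((k : ℝ) + 1) • A := by
  rw [← sum_wedge_contr, Fin.sum_univ_add]

/-! ### The relation between `L` and `Λ`, and injectivity of `L` -/

theorem lef_apply (A : Alt n k) : lef n k A =
    ∑ i : Fin n, wedge (k + 1) (dx (Fin.castAdd n i)) (wedge k (dx (Fin.natAdd n i)) A) := by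
  simp [lef]

theorem dualLef_apply (A : Alt n (k + 2)) : dualLef n k A =
    ∑ i : Fin n, contr (ex (Fin.natAdd n i)) (contr (ex (Fin.castAdd n i)) A) := rfl

theorem dx_castAdd_ex_castAdd (i j : Fin n) :
    dx (Fin.castAdd n i) (ex (Fin.castAdd n j)) = if i = j then 1 else 0 := by
  simp [dx_ex]

theorem dx_natAdd_ex_natAdd (i j : Fin n) :
    dx (Fin.natAdd n i) (ex (Fin.natAdd n j)) = if i = j then 1 else 0 := by
  simp [dx_ex]

theorem castAdd_ne_natAdd (i j : Fin n) : Fin.castAdd n i ≠ Fin.natAdd n j := by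
  intro h
  have := congrArg Fin.val h
  simp at this
  omega

theorem dx_castAdd_ex_natAdd (i j : Fin n) :
    dx (Fin.castAdd n i) (ex (Fin.natAdd n j)) = 0 := by
  rw [dx_ex, if_neg (castAdd_ne_natAdd i j)]

theorem dx_natAdd_ex_castAdd (i j : Fin n) :
    dx (Fin.natAdd n i) (ex (Fin.castAdd n j)) = 0 := by
  rw [dx_ex, if_neg (castAdd_ne_natAdd j i).symm]

/-- Different symplectic planes do not interact; on the diagonal the correction is 1 minus the
degree operator of the `i`-th plane, and these sum to `n` minus the degree. Degrees 1 and 0 need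
separate versions because `A` cannot be contracted twice there. -/
theorem contr_contr_wedge_wedge (A : Alt n (k + 2)) (i j : Fin n) :
    contr (ex (Fin.natAdd n j)) (contr (ex (Fin.castAdd n j))
      (wedge (k + 3) (dx (Fin.castAdd n i)) (wedge (k + 2) (dx (Fin.natAdd n i)) A)))
    = wedge (k + 1) (dx (Fin.castAdd n i)) (wedge k (dx (Fin.natAdd n i))
        (contr (ex (Fin.natAdd n j)) (contr (ex (Fin.castAdd n j)) A)))
      + if i = j then A - (wedge (k + 1) (dx (Fin.castAdd n i)) (contr (ex (Fin.castAdd n i)) A)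
        + wedge (k + 1) (dx (Fin.natAdd n i)) (contr (ex (Fin.natAdd n i)) A)) else 0 := by
  simp only [contr_wedge, dx_castAdd_ex_castAdd, dx_natAdd_ex_natAdd, dx_castAdd_ex_natAdd,
    dx_natAdd_ex_castAdd, map_sub, zero_smul, zero_sub, map_neg]
  by_cases h : i = j
  · subst h
    simp only [if_true, one_smul, contr_wedge, dx_natAdd_ex_natAdd]
    abel
  · simp [h]

theorem contr_contr_wedge_wedge_one (A : Alt n 1) (i j : Fin n) :
    contr (ex (Fin.natAdd n j)) (contr (ex (Fin.castAdd n j))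
      (wedge (1 + 1) (dx (Fin.castAdd n i)) (wedge 1 (dx (Fin.natAdd n i)) A)))
    = if i = j then A - (wedge 0 (dx (Fin.castAdd n i)) (contr (ex (Fin.castAdd n i)) A)
        + wedge 0 (dx (Fin.natAdd n i)) (contr (ex (Fin.natAdd n i)) A)) else 0 := by
  simp only [contr_wedge, dx_castAdd_ex_castAdd, dx_natAdd_ex_natAdd, dx_castAdd_ex_natAdd,
    dx_natAdd_ex_castAdd, map_sub, zero_smul, zero_sub, map_neg, contr_wedge_zero]
  by_cases h : i = j
  · subst h
    simp only [if_true, one_smul, contr_wedge, dx_natAdd_ex_natAdd]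
    abel
  · simp [h]

theorem contr_contr_wedge_wedge_zero (A : Alt n 0) (i j : Fin n) :
    contr (ex (Fin.natAdd n j)) (contr (ex (Fin.castAdd n j))
      (wedge (0 + 1) (dx (Fin.castAdd n i)) (wedge 0 (dx (Fin.natAdd n i)) A)))
    = if i = j then A else 0 := by
  simp only [contr_wedge, dx_castAdd_ex_castAdd, dx_natAdd_ex_castAdd, map_sub, zero_smul,
    contr_wedge_zero]
  by_cases h : i = j
  · subst h
    rw [if_pos rfl, if_pos rfl, one_smul, smul_zero, sub_zero, contr_wedge_zero,
      dx_natAdd_ex_natAdd, if_pos rfl, one_smul]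
  · simp [h]

/-- The commutation relation `[Λ, L] = n - k` on forms of degree `k ≥ 2`. -/
theorem dualLef_lef (A : Alt n (k + 2)) :
    dualLef n (k + 2) (lef n (k + 2) A)
      = lef n k (dualLef n k A) + ((n : ℝ) - (k + 2)) • A := by
  have h := sum_wedge_contr_add A
  simp only [lef_apply, dualLef_apply, _root_.map_sum]
  simp only [contr_contr_wedge_wedge, Finset.sum_add_distrib, Finset.sum_ite_eq,
      Finset.mem_univ, if_true, Finset.sum_sub_distrib, h]
  rw [Finset.sum_comm]
  simp only [Finset.sum_const, Finset.card_univ, Fintype.card_fin]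
  push_cast
  module

theorem dualLef_lef_zero (A : Alt n 0) :
    dualLef n 0 (lef n 0 A) = (n : ℝ) • A := by
  simp only [lef_apply, dualLef_apply, _root_.map_sum]
  simp only [contr_contr_wedge_wedge_zero]
  simp [Nat.cast_smul_eq_nsmul]

theorem dualLef_lef_one (A : Alt n 1) :
    dualLef n 1 (lef n 1 A) = ((n : ℝ) - 1) • A := by
  have h := sum_wedge_contr_add A
  simp only [lef_apply, dualLef_apply, _root_.map_sum]
  simp only [contr_contr_wedge_wedge_one, Finset.sum_add_distrib, Finset.sum_ite_eq,
      Finset.mem_univ, if_true, Finset.sum_sub_distrib, h]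
  simp only [Finset.sum_const, Finset.card_univ, Fintype.card_fin]
  push_cast
  module

/-- `L Λ` has no negative eigenvalues in degrees at most `n`. -/
theorem eq_zero_of_lef_dualLef_eq (k : ℕ) : k + 2 ≤ n → ∀ μ : ℝ, 0 < μ → ∀ A : Alt n (k + 2),
    lef n k (dualLef n k A) = -μ • A → A = 0 := by
  induction k using Nat.twoStepInduction with
  | zero =>
    intro hk μ hμ A hA
    have h := congrArg (dualLef n 0) hA
    rw [dualLef_lef_zero, map_smul] at h
    -- In the base cases `ΛL` is a nonnegative scalar on the degree of `ΛA`, so it cannot act there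
    -- as `-μ`.
    have h2 : ((n : ℝ) + μ) • dualLef n 0 A = 0 := by rw [add_smul, h]; module
    have h3 : dualLef n 0 A = 0 := (smul_eq_zero.1 h2).resolve_left (by positivity)
    rw [h3, map_zero] at hA
    exact (smul_eq_zero.1 hA.symm).resolve_left (by linarith)
  | one =>
    intro hk μ hμ A hA
    have h := congrArg (dualLef n 1) hA
    rw [dualLef_lef_one, map_smul] at h
    have h2 : ((n : ℝ) - 1 + μ) • dualLef n 1 A = 0 := by rw [add_smul, h]; module
    have hn : (3 : ℝ) ≤ n := by exact_mod_cast hk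
    have h3 : dualLef n 1 A = 0 := (smul_eq_zero.1 h2).resolve_left (by linarith)
    rw [h3, map_zero] at hA
    exact (smul_eq_zero.1 hA.symm).resolve_left (by linarith)
  | more k ih _ =>
    intro hk μ hμ A hA
    have h := congrArg (dualLef n (k + 2)) hA
    rw [dualLef_lef, map_smul] at h
    have hn : ((k : ℝ) + 2 + 2) ≤ n := by exact_mod_cast hk
    have h3 : dualLef n (k + 2) A = 0 := by
      -- `ΛA` is again an eigenvector of `LΛ`, two degrees lower; commuting `Λ` past `L` increases
      -- `μ` by `n - (k + 2)`, which is positive here.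
      refine ih (by omega) (μ + (n - (k + 2))) (by linarith) _ ?_
      rw [eq_sub_of_add_eq h]
      module
    rw [h3, map_zero] at hA
    exact (smul_eq_zero.1 hA.symm).resolve_left (by linarith)

theorem eq_zero_of_dualLef_lef_eq_zero (hk : k < n) {A : Alt n k}
    (hA : dualLef n k (lef n k A) = 0) : A = 0 := by
  have hn : (k : ℝ) < n := by exact_mod_cast hk
  match k, A, hA, hn with
  | 0, A, hA, hn =>
    rw [dualLef_lef_zero] at hA
    exact (smul_eq_zero.1 hA).resolve_left (by simpa using hn.ne')
  | 1, A, hA, hn =>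
    rw [dualLef_lef_one] at hA
    push_cast at hn
    exact (smul_eq_zero.1 hA).resolve_left (by linarith)
  | k + 2, A, hA, hn =>
    rw [dualLef_lef] at hA
    push_cast at hn
    refine eq_zero_of_lef_dualLef_eq k (by omega) (n - (k + 2)) (by linarith) A ?_
    rw [eq_neg_of_add_eq_zero_left hA]
    exact (neg_smul _ _).symm

theorem lef_injective (hk : k < n) : Function.Injective (lef n k) :=
  (injective_iff_map_eq_zero _).2 fun A hA =>
    eq_zero_of_dualLef_lef_eq_zero hk (by rw [hA, map_zero])

theorem dualLef_lef_of_mem_primAlt {A : Alt n k} (hA : A ∈ primAlt n k) :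
    dualLef n k (lef n k A) = ((n : ℝ) - k) • A := by
  match k, A, hA with
  | 0, A, hA => simpa using dualLef_lef_zero A
  | 1, A, hA => simpa using dualLef_lef_one A
  | k + 2, A, hA =>
    have h : dualLef n k A = 0 := hA
    rw [dualLef_lef, h]
    simp

instance finiteDimensional_alt : FiniteDimensional ℝ (Alt n k) :=
  let f : Alt n k →ₗ[ℝ] MultilinearMap ℝ (fun _ : Fin k => Space n) ℝ :=
    { toFun := fun A => A.toContinuousMultilinearMap.toMultilinearMap
      map_add' := fun _ _ => rfl
      map_smul' := fun _ _ => rfl }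
  Module.Finite.of_injective f (ContinuousMultilinearMap.toMultilinearMap_injective.comp
    ContinuousAlternatingMap.toContinuousMultilinearMap_injective)

/-- The Lefschetz decomposition `A = A₀ + L (P A)` with `A₀` primitive. -/
theorem exists_dualLef_sub_lef_eq_zero (hk : k < n) :
    ∃ P : Alt n (k + 2) →L[ℝ] Alt n k, ∀ A, dualLef n k (A - lef n k (P A)) = 0 := by
  let T : Alt n k →ₗ[ℝ] Alt n k := (dualLef n k).comp (lef n k).toLinearMap
  have hT : Function.Injective T :=
    (injective_iff_map_eq_zero _).2 fun A hA => eq_zero_of_dualLef_lef_eq_zero hk hA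
  let e := LinearEquiv.ofInjectiveEndo T hT
  -- `ΛL` is injective in finite dimension, hence invertible, and `P = (ΛL)⁻¹Λ` solves `ΛL(P A) =
  -- ΛA`.
  refine ⟨LinearMap.toContinuousLinearMap (e.symm.toLinearMap.comp (dualLef n k)), fun A => ?_⟩
  have h : T (e.symm (dualLef n k A)) = dualLef n k A := e.apply_symm_apply _
  rw [map_sub, sub_eq_zero]
  exact h.symm

theorem contr_smul_left (r : ℝ) (v : Space n) (A : Alt n (k + 1)) :
    contr (r • v) A = r • contr v A := by
  simp [contr_eq_curryLeft]

theorem contr_sub_left (v w : Space n) (A : Alt n (k + 1)) :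
    contr (v - w) A = contr v A - contr w A := by
  simp [contr_eq_curryLeft]

theorem contr_sum_left {ι : Type*} (s : Finset ι) (v : ι → Space n) (A : Alt n (k + 1)) :
    contr (∑ i ∈ s, v i) A = ∑ i ∈ s, contr (v i) A := by
  simp [contr_eq_curryLeft]

theorem dualLef_contr (v : Space n) (A : Alt n (k + 3)) :
    dualLef n k (contr v A) = contr v (dualLef n (k + 1) A) := by
  simp only [dualLef_apply, _root_.map_sum]
  refine Finset.sum_congr rfl fun i _ => ?_
  rw [contr_contr_comm A v, map_neg, contr_contr_comm _ v, neg_neg]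

/-- `[Λ, f ∧ ·]` is the contraction with the Hamiltonian vector of `f`. -/
theorem exists_dualLef_wedge (f : Space n →L[ℝ] ℝ) : ∃ v : Space n, ∀ A : Alt n (k + 2),
    dualLef n (k + 1) (wedge (k + 2) f A) = contr v A + wedge k f (dualLef n k A) := by
  refine ⟨∑ i : Fin n, (f (ex (Fin.castAdd n i)) • ex (Fin.natAdd n i)
    - f (ex (Fin.natAdd n i)) • ex (Fin.castAdd n i)), fun A => ?_⟩
  rw [contr_sum_left]
  simp only [dualLef_apply, _root_.map_sum]
  rw [← Finset.sum_add_distrib]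
  refine Finset.sum_congr rfl fun i _ => ?_
  rw [contr_wedge, map_sub, contr_wedge, map_smul, contr_sub_left, contr_smul_left,
    contr_smul_left]
  abel

/-- The first `Λ` turns `f ∧ A` into a contraction of `A`; contractions commute with `Λ`, so the
second `Λ` reaches `A`. -/
theorem dualLef_dualLef_wedge (f : Space n →L[ℝ] ℝ) {A : Alt n (k + 3)}
    (hA : dualLef n (k + 1) A = 0) :
    dualLef n k (dualLef n (k + 2) (wedge (k + 3) f A)) = 0 := by
  obtain ⟨v, hv⟩ := exists_dualLef_wedge (k := k + 1) f
  rw [hv, hA, map_zero, add_zero, dualLef_contr, hA, map_zero]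

/-- The pointwise form of the decomposition `d B = B⁰ + L B¹` of the derivative of a primitive
form. -/
theorem dualLef_alternatizeUncurryFin_mem_primAlt {T : Space n →L[ℝ] Alt n (k + 1)}
    (hT : ∀ v, T v ∈ primAlt n (k + 1)) :
    dualLef n k (alternatizeUncurryFin T) ∈ primAlt n k := by
  match k, T, hT with
  | 0, T, hT => trivial
  | 1, T, hT => trivial
  | k + 2, T, hT =>
    change dualLef n k _ = 0
    rw [alternatizeUncurryFin_eq_sum, _root_.map_sum, _root_.map_sum]
    exact Finset.sum_eq_zero fun j _ => dualLef_dualLef_wedge _ (hT _)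

theorem lef_wedge (f : Space n →L[ℝ] ℝ) (A : Alt n k) :
    lef n (k + 1) (wedge k f A) = wedge (k + 2) f (lef n k A) := by
  simp only [lef_apply, _root_.map_sum]
  refine Finset.sum_congr rfl fun i _ => ?_
  rw [wedge_wedge_comm (dx (Fin.natAdd n i)) f A, map_neg,
    wedge_wedge_comm (dx (Fin.castAdd n i)) f, neg_neg]

/-- The pointwise form of `dL = Ld`: ω has constant coefficients and even degree. -/
theorem alternatizeUncurryFin_lef_comp (T : Space n →L[ℝ] Alt n k) :
    alternatizeUncurryFin ((lef n k).comp T) = lef n (k + 1) (alternatizeUncurryFin T) := by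
  simp only [alternatizeUncurryFin_eq_sum, _root_.map_sum, lef_wedge]
  rfl

end

/-! ### Integrals depending on a parameter -/

section

open Set Filter Topology MeasureTheory intervalIntegral in
theorem hasFDerivAt_intervalIntegral_of_contDiffOn {E F : Type} [NormedAddCommGroup E]
    [NormedSpace ℝ E] [ProperSpace E] [NormedAddCommGroup F] [NormedSpace ℝ F] [CompleteSpace F]
    {W : Set (E × ℝ)} (hW : IsOpen W) {g : E × ℝ → F} (hg : ContDiffOn ℝ ∞ g W) {x : E}
    (hx : ∀ t ∈ Icc (0 : ℝ) 1, (x, t) ∈ W) :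
    HasFDerivAt (fun y => ∫ t in (0 : ℝ)..1, g (y, t))
      (∫ t in (0 : ℝ)..1, (fderiv ℝ g (x, t)).comp (ContinuousLinearMap.inl ℝ E ℝ)) x := by
  have hsub : ({x} : Set E) ×ˢ Icc (0 : ℝ) 1 ⊆ W := by
    rintro ⟨y, t⟩ ⟨rfl, ht⟩
    exact hx t ht
  -- The tube lemma gives a compact product of a closed ball with `[0, 1]` inside `W`, on which the
  -- derivative is bounded; this bound is the dominating function.
  obtain ⟨u, v, hu, -, hxu, hv, huv⟩ :=
    generalized_tube_lemma isCompact_singleton isCompact_Icc hW hsub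
  obtain ⟨ε, hε, hball⟩ := Metric.nhds_basis_closedBall.mem_iff.1
    (hu.mem_nhds (hxu (mem_singleton x)))
  have hK : Metric.closedBall x ε ×ˢ Icc (0 : ℝ) 1 ⊆ W := (prod_mono hball hv).trans huv
  let g' : E × ℝ → E →L[ℝ] F := fun p => (fderiv ℝ g p).comp (ContinuousLinearMap.inl ℝ E ℝ)
  have hg' : ContinuousOn g' W := by
    have h : ContinuousOn (fderiv ℝ g) W := hg.continuousOn_fderiv_of_isOpen hW (by simp)
    exact h.clm_comp continuousOn_const
  obtain ⟨C, hC⟩ := ((isCompact_closedBall x ε).prod isCompact_Icc).exists_bound_of_continuousOn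
    (hg'.mono hK)
  have hslice : ∀ y ∈ Metric.closedBall x ε, ∀ {G : Type} [NormedAddCommGroup G] (f : E × ℝ → G),
      ContinuousOn f W → ContinuousOn (fun t => f (y, t)) (uIcc (0 : ℝ) 1) := by
    intro y hy G _ f hf
    rw [uIcc_of_le zero_le_one]
    exact hf.comp (by fun_prop) fun t ht => hK ⟨hy, ht⟩
  have hxx : x ∈ Metric.closedBall x ε := Metric.mem_closedBall_self hε.le
  refine hasFDerivAt_integral_of_dominated_of_fderiv_le (F' := fun y t => g' (y, t))
    (bound := fun _ => C) (Metric.closedBall_mem_nhds x hε) ?_ ?_ ?_ ?_ ?_ ?_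
  · filter_upwards [Metric.closedBall_mem_nhds x hε] with y hy
    exact (hslice y hy g hg.continuousOn).intervalIntegrable.def'.aestronglyMeasurable
  · exact (hslice x hxx g hg.continuousOn).intervalIntegrable
  · exact (hslice x hxx g' hg').intervalIntegrable.def'.aestronglyMeasurable
  · refine Eventually.of_forall fun t ht y hy => hC _ ⟨hy, ?_⟩
    rw [uIoc_of_le zero_le_one] at ht
    exact Ioc_subset_Icc_self ht
  · exact intervalIntegrable_const
  · refine Eventually.of_forall fun t ht y hy => ?_
    rw [uIoc_of_le zero_le_one] at ht
    have hyt : (y, t) ∈ W := hK ⟨hy, Ioc_subset_Icc_self ht⟩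
    have h := ((hg.contDiffAt (hW.mem_nhds hyt)).differentiableAt (by simp)).hasFDerivAt
    exact h.comp y (hasFDerivAt_prodMk_left y t)

open Set Filter Topology MeasureTheory intervalIntegral in
-- The target space is quantified inside the induction because the derivative is an integral of the
-- same kind with values in `E →L[ℝ] F`.
theorem contDiffOn_nat_intervalIntegral (m : ℕ) : ∀ {E F : Type} [NormedAddCommGroup E]
    [NormedSpace ℝ E] [ProperSpace E] [NormedAddCommGroup F] [NormedSpace ℝ F] [CompleteSpace F]
    {W : Set (E × ℝ)} (_ : IsOpen W) {g : E × ℝ → F} (_ : ContDiffOn ℝ ∞ g W) {U : Set E}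
    (_ : IsOpen U) (_ : U ×ˢ Icc (0 : ℝ) 1 ⊆ W),
    ContDiffOn ℝ m (fun y => ∫ t in (0 : ℝ)..1, g (y, t)) U := by
  induction m with
  | zero =>
    intro E F _ _ _ _ _ _ W hW g hg U hU hUW
    refine contDiffOn_zero.2 fun x hx => ?_
    exact (hasFDerivAt_intervalIntegral_of_contDiffOn hW hg
      fun t ht => hUW ⟨hx, ht⟩).continuousAt.continuousWithinAt
  | succ m ih =>
    intro E F _ _ _ _ _ _ W hW g hg U hU hUW
    have hd : ∀ x ∈ U, HasFDerivAt (fun y => ∫ t in (0 : ℝ)..1, g (y, t))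
      (∫ t in (0 : ℝ)..1, (fderiv ℝ g (x, t)).comp (ContinuousLinearMap.inl ℝ E ℝ)) x :=
      fun x hx => hasFDerivAt_intervalIntegral_of_contDiffOn hW hg fun t ht => hUW ⟨hx, ht⟩
    push_cast
    rw [contDiffOn_succ_iff_fderiv_of_isOpen hU]
    refine ⟨fun x hx => (hd x hx).differentiableAt.differentiableWithinAt, by simp, ?_⟩
    have hg' : ContDiffOn ℝ ∞
        (fun p => (fderiv ℝ g p).comp (ContinuousLinearMap.inl ℝ E ℝ)) W :=
      (hg.fderiv_of_isOpen hW (by simp)).clm_comp contDiffOn_const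
    exact (ih hW hg' hU hUW).congr fun x hx => (hd x hx).fderiv

/-- Smooth dependence on the parameter of an integral over `[0, 1]`. -/
theorem contDiffOn_intervalIntegral {E F : Type} [NormedAddCommGroup E]
    [NormedSpace ℝ E] [ProperSpace E] [NormedAddCommGroup F] [NormedSpace ℝ F] [CompleteSpace F]
    {W : Set (E × ℝ)} (hW : IsOpen W) {g : E × ℝ → F} (hg : ContDiffOn ℝ ∞ g W) {U : Set E}
    (hU : IsOpen U) (hUW : U ×ˢ Set.Icc (0 : ℝ) 1 ⊆ W) :
    ContDiffOn ℝ ∞ (fun y => ∫ t in (0 : ℝ)..1, g (y, t)) U :=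
  contDiffOn_infty.2 fun m => contDiffOn_nat_intervalIntegral m hW hg hU hUW

/-! ### The Poincaré lemma -/

open ContinuousAlternatingMap (alternatizeUncurryFin alternatizeUncurryFinCLM)

variable {n k : ℕ}

theorem map_eq_sum_ex (T : Space n →L[ℝ] Alt n k) (y : Space n) :
    T y = ∑ j, dx j y • T (ex j) := by
  conv_lhs => rw [← sum_smul_ex y]
  simp [_root_.map_sum, dx_apply]

/-- The pointwise form of Cartan's formula. -/
theorem alternatizeUncurryFin_contr_comp (T : Space n →L[ℝ] Alt n (k + 1)) (y : Space n) :
    alternatizeUncurryFin ((contr y).comp T) = T y - contr y (alternatizeUncurryFin T) := by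
  rw [alternatizeUncurryFin_eq_sum, alternatizeUncurryFin_eq_sum, _root_.map_sum]
  simp only [contr_wedge]
  rw [Finset.sum_sub_distrib]
  simp only [ContinuousLinearMap.comp_apply]
  rw [map_eq_sum_ex T y, sub_sub_cancel]

theorem segment_mem_disk {c x : Space n} (hx : x ∈ disk c) {t : ℝ} (ht : t ∈ Set.Icc (0 : ℝ) 1) :
    c + t • (x - c) ∈ disk c := by
  have h : ‖x - c‖ < 1 := by simpa [disk, dist_eq_norm] using hx
  change _ ∈ Metric.ball c 1
  rw [Metric.mem_ball, dist_eq_norm, add_sub_cancel_left, norm_smul, Real.norm_of_nonneg ht.1]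
  exact (mul_le_of_le_one_left (norm_nonneg _) ht.2).trans_lt h

/-- The integrand of the homotopy operator of the Poincaré lemma, the contraction of
`tᵏ α (c + t (x - c))` with `x - c`. -/
def homotopyIntegrand {c : Space n} (α : Form (disk c) (k + 1)) (p : Space n × ℝ) : Alt n k :=
  p.2 ^ k • ∑ j, dx j (p.1 - c) • contr (ex j) (α.at (c + p.2 • (p.1 - c)))

/-- The pairs `(x, t)` with `c + t (x - c)` in the disk. -/
def homotopyDomain (c : Space n) : Set (Space n × ℝ) :=
  (fun p : Space n × ℝ => c + p.2 • (p.1 - c)) ⁻¹' (disk c : Set (Space n))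

theorem isOpen_homotopyDomain (c : Space n) : IsOpen (homotopyDomain c) :=
  (disk c).isOpen.preimage (by fun_prop)

theorem prod_subset_homotopyDomain (c : Space n) :
    (disk c : Set (Space n)) ×ˢ Set.Icc (0 : ℝ) 1 ⊆ homotopyDomain c :=
  fun _ hp => segment_mem_disk hp.1 hp.2

theorem contDiffOn_homotopyIntegrand {c : Space n} (α : Form (disk c) (k + 1)) :
    ContDiffOn ℝ ∞ (homotopyIntegrand α) (homotopyDomain c) := by
  have h1 : ContDiff ℝ ∞ (fun p : Space n × ℝ => c + p.2 • (p.1 - c)) := by fun_prop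
  have h2 : ContDiffOn ℝ ∞ (fun p : Space n × ℝ => α.at (c + p.2 • (p.1 - c)))
      (homotopyDomain c) := α.contDiffOn.comp h1.contDiffOn fun p hp => hp
  have h3 : ∀ j, ContDiffOn ℝ ∞
      (fun p : Space n × ℝ => contr (ex j) (α.at (c + p.2 • (p.1 - c)))) (homotopyDomain c) :=
    fun j => (contr (ex j)).contDiff.comp_contDiffOn h2
  have h4 : ∀ j, ContDiffOn ℝ ∞ (fun p : Space n × ℝ => dx j (p.1 - c)) (homotopyDomain c) :=
    fun j => ((dx j).contDiff.comp (contDiff_fst.sub contDiff_const)).contDiffOn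
  have h5 : ContDiffOn ℝ ∞ (fun p : Space n × ℝ => p.2 ^ k) (homotopyDomain c) :=
    (contDiff_snd.pow k).contDiffOn
  exact h5.smul (ContDiffOn.sum fun j _ => (h4 j).smul (h3 j))

theorem hasFDerivAt_homotopyIntegrand {c : Space n} (α : Form (disk c) (k + 1)) {x : Space n}
    {t : ℝ} (h : c + t • (x - c) ∈ disk c) :
    HasFDerivAt (fun y => homotopyIntegrand α (y, t))
      (t ^ k • ∑ j, (dx j (x - c) • ((contr (ex j)).comp
          ((fderiv ℝ α.at (c + t • (x - c))).comp (t • ContinuousLinearMap.id ℝ (Space n)))) +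
        (dx j).smulRight (contr (ex j) (α.at (c + t • (x - c)))))) x := by
  have h1 : HasFDerivAt (fun y : Space n => c + t • (y - c))
      (t • ContinuousLinearMap.id ℝ (Space n)) x :=
    (((hasFDerivAt_id x).sub_const c).const_smul t).const_add c
  have h2 := (α.differentiableAt h).hasFDerivAt.comp x h1
  have h3 : ∀ j, HasFDerivAt (fun y : Space n => contr (ex j) (α.at (c + t • (y - c)))) _ x :=
    fun j => (contr (ex j)).hasFDerivAt.comp x h2
  have h4 : ∀ j, HasFDerivAt (fun y : Space n => dx j (y - c)) (dx j) x := fun j =>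
    (dx j).hasFDerivAt.comp x ((hasFDerivAt_id x).sub_const c)
  exact (HasFDerivAt.fun_sum fun j _ => (h4 j).fun_smul (h3 j)).const_smul (t ^ k)

/-- Differentiating α gives the first term, by Cartan's formula and `dα = 0`, with one more factor
`t` from the chain rule. Differentiating the coefficients `dxʲ(x - c)` gives the degree operator and
so the second term. The sum is the `t`-derivative of `tᵏ⁺¹ α(c + t(x - c))`. -/
theorem alternatizeUncurryFin_fderiv_homotopyIntegrand {c : Space n} (α : Form (disk c) (k + 1))
    {x : Space n} {t : ℝ} (h : c + t • (x - c) ∈ disk c)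
    (hα : extDeriv α.at (c + t • (x - c)) = 0) :
    alternatizeUncurryFin ((fderiv ℝ (homotopyIntegrand α) (x, t)).comp
        (ContinuousLinearMap.inl ℝ (Space n) ℝ)) =
      t ^ (k + 1) • fderiv ℝ α.at (c + t • (x - c)) (x - c) +
        (((k : ℝ) + 1) * t ^ k) • α.at (c + t • (x - c)) := by
  have hm : (x, t) ∈ homotopyDomain c := h
  have hd : DifferentiableAt ℝ (homotopyIntegrand α) (x, t) :=
    ((contDiffOn_homotopyIntegrand α).contDiffAt
      ((isOpen_homotopyDomain c).mem_nhds hm)).differentiableAt (by simp)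
  have hc : HasFDerivAt (fun y => homotopyIntegrand α (y, t))
      ((fderiv ℝ (homotopyIntegrand α) (x, t)).comp (ContinuousLinearMap.inl ℝ (Space n) ℝ)) x :=
    HasFDerivAt.comp (g := homotopyIntegrand α) x hd.hasFDerivAt (hasFDerivAt_prodMk_left x t)
  have he := hc.unique (hasFDerivAt_homotopyIntegrand α h)
  rw [he]
  have hT : alternatizeUncurryFin ((fderiv ℝ α.at (c + t • (x - c))).comp
      (t • ContinuousLinearMap.id ℝ (Space n))) = 0 := by
    rw [ContinuousLinearMap.comp_smul, ContinuousLinearMap.comp_id,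
      ContinuousAlternatingMap.alternatizeUncurryFin_smul]
    exact (congrArg (t • ·) hα).trans (smul_zero t)
  have hw : ∀ j, alternatizeUncurryFin
      ((dx j).smulRight (contr (ex j) (α.at (c + t • (x - c))))) =
        wedge k (dx j) (contr (ex j) (α.at (c + t • (x - c)))) := fun _ => rfl
  have hx : fderiv ℝ α.at (c + t • (x - c)) (x - c) =
      ∑ j, dx j (x - c) • fderiv ℝ α.at (c + t • (x - c)) (ex j) :=
    map_eq_sum_ex _ _
  rw [ContinuousAlternatingMap.alternatizeUncurryFin_smul,
    ← ContinuousAlternatingMap.alternatizeUncurryFinCLM_apply, _root_.map_sum]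
  simp only [ContinuousAlternatingMap.alternatizeUncurryFinCLM_apply,
    ContinuousAlternatingMap.alternatizeUncurryFin_add,
    ContinuousAlternatingMap.alternatizeUncurryFin_smul,
    alternatizeUncurryFin_contr_comp, hT, hw, Finset.sum_add_distrib, sum_wedge_contr,
    map_zero, sub_zero]
  rw [hx]
  simp only [ContinuousLinearMap.comp_apply, smul_apply, map_smul,
    ContinuousLinearMap.id_apply, smul_comm _ t, ← Finset.smul_sum]
  module

theorem hasDerivAt_pow_smul_segment {c : Space n} (α : Form (disk c) (k + 1))
    {x : Space n} {t : ℝ} (h : c + t • (x - c) ∈ disk c) :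
    HasDerivAt (fun s : ℝ => s ^ (k + 1) • α.at (c + s • (x - c)))
      (t ^ (k + 1) • fderiv ℝ α.at (c + t • (x - c)) (x - c) +
        (((k : ℝ) + 1) * t ^ k) • α.at (c + t • (x - c))) t := by
  have h1 : HasDerivAt (fun s : ℝ => c + s • (x - c)) (x - c) t := by
    simpa using ((hasDerivAt_id t).smul_const (x - c)).const_add c
  have h2 : HasDerivAt (fun s : ℝ => α.at (c + s • (x - c)))
    (fderiv ℝ α.at (c + t • (x - c)) (x - c)) t :=
      (α.differentiableAt h).hasFDerivAt.comp_hasDerivAt t h1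
  have h3 := (hasDerivAt_pow (k + 1) t).fun_smul h2
  simpa using h3

open MeasureTheory in
-- Used with `Φ` the alternation, so that the left side is `d` of the homotopy integral: `Φ` passes
-- through the integral, and the fundamental theorem of calculus applies to `f`.
theorem map_fderiv_intervalIntegral {E F G : Type} [NormedAddCommGroup E]
    [NormedSpace ℝ E] [ProperSpace E] [NormedAddCommGroup F] [NormedSpace ℝ F] [CompleteSpace F]
    [NormedAddCommGroup G] [NormedSpace ℝ G] [CompleteSpace G]
    {W : Set (E × ℝ)} (hW : IsOpen W) {g : E × ℝ → F} (hg : ContDiffOn ℝ ∞ g W) {x : E}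
    (hx : ∀ t ∈ Set.Icc (0 : ℝ) 1, (x, t) ∈ W) (Φ : (E →L[ℝ] F) →L[ℝ] G) {f : ℝ → G}
    (hf : ∀ t ∈ Set.Icc (0 : ℝ) 1, HasDerivAt f
      (Φ ((fderiv ℝ g (x, t)).comp (ContinuousLinearMap.inl ℝ E ℝ))) t) :
    Φ (fderiv ℝ (fun y => ∫ t in (0 : ℝ)..1, g (y, t)) x) = f 1 - f 0 := by
  rw [← Set.uIcc_of_le zero_le_one] at hx hf
  have hcont : ContinuousOn (fun t : ℝ => (fderiv ℝ g (x, t)).comp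
        (ContinuousLinearMap.inl ℝ E ℝ)) (Set.uIcc 0 1) := by
    have h := hg.continuousOn_fderiv_of_isOpen hW (by simp)
    exact (h.comp (f := fun t : ℝ => (x, t)) (by fun_prop) hx).clm_comp continuousOn_const
  have hΦ := Φ.continuous.comp_continuousOn hcont
  rw [Set.uIcc_of_le zero_le_one] at hx
  rw [(hasFDerivAt_intervalIntegral_of_contDiffOn hW hg hx).fderiv,
    ← Φ.intervalIntegral_comp_comm hcont.intervalIntegrable,
    intervalIntegral.integral_eq_sub_of_hasDerivAt hf hΦ.intervalIntegrable]

theorem extD_at {U : TopologicalSpace.Opens (Space n)} (α : Form U k) {x : Space n} (hx : x ∈ U) :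
    (extD U k α).at x = extDeriv α.at x := by
  rw [extD, LinearMap.coe_mk, AddHom.coe_mk, restrictForm_apply _ hx]

/-- The Poincaré lemma on the disk. -/
theorem exists_extD_eq {c : Space n} (α : Form (disk c) (k + 1))
    (hα : extD (disk c) (k + 1) α = 0) : ∃ β : Form (disk c) k, extD (disk c) k β = α := by
  have hcl : ∀ x ∈ disk c, extDeriv α.at x = 0 := fun x hx => by
    rw [← extD_at α hx, hα]
    rfl
  have hsm := contDiffOn_intervalIntegral (isOpen_homotopyDomain c)
    (contDiffOn_homotopyIntegrand α) (disk c).isOpen (prod_subset_homotopyDomain c)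
  refine ⟨restrictForm (disk c) _ hsm, Form.ext fun x hx => ?_⟩
  rw [extD_at _ hx]
  have heq : (restrictForm (disk c) _ hsm).at =ᶠ[nhds x]
      fun y => ∫ t in (0 : ℝ)..1, homotopyIntegrand α (y, t) := by
    filter_upwards [(disk c).isOpen.mem_nhds hx] with y hy
    exact restrictForm_apply hsm hy
  rw [heq.extDeriv_eq]
  refine (map_fderiv_intervalIntegral (isOpen_homotopyDomain c) (contDiffOn_homotopyIntegrand α)
    (fun t ht => segment_mem_disk hx ht) (alternatizeUncurryFinCLM ℝ (Space n) ℝ)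
    (f := fun s : ℝ => s ^ (k + 1) • α.at (c + s • (x - c))) fun t ht => ?_).trans ?_
  · have h := segment_mem_disk hx ht
    exact (hasDerivAt_pow_smul_segment α h).congr_deriv
      (alternatizeUncurryFin_fderiv_homotopyIntegrand α h (hcl _ h)).symm
  -- The boundary term at `t = 0` vanishes because the exponent `k + 1` is positive.
  · simp

end

/-! ### Operators on forms and vanishing in degrees at least 2 -/

section

open ContinuousAlternatingMap (alternatizeUncurryFin alternatizeUncurryFinCLM)

variable {n k l : ℕ} {U : TopologicalSpace.Opens (Space n)}

theorem lefForm_at (α : Form U k) (x : Space n) : (lefForm U k α).at x = lef n k (α.at x) := rfl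

/-- The action on forms of a linear map with constant coefficients. -/
def Form.map (T : Alt n k →L[ℝ] Alt n l) (α : Form U k) : Form U l :=
  ⟨fun x => T (α.at x), T.contDiff.comp_contDiffOn α.contDiffOn,
    fun x hx => by simp [α.at_of_notMem hx]⟩

/-- `Λ` as a continuous linear map. -/
def dualLefL (n k : ℕ) : Alt n (k + 2) →L[ℝ] Alt n k :=
  LinearMap.toContinuousLinearMap (dualLef n k)

theorem extDeriv_map (T : Alt n k →L[ℝ] Alt n l) (α : Form U k) {x : Space n} (hx : x ∈ U) :
    extDeriv (α.map T).at x = alternatizeUncurryFin (T.comp (fderiv ℝ α.at x)) := by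
  have h : HasFDerivAt (α.map T).at (T.comp (fderiv ℝ α.at x)) x :=
    T.hasFDerivAt.comp x (α.differentiableAt hx).hasFDerivAt
  rw [extDeriv, h.fderiv]

theorem extD_extD (α : Form U k) : extD U (k + 1) (extD U k α) = 0 := by
  refine Form.ext fun x hx => ?_
  have h : (extD U k α).at =ᶠ[nhds x] extDeriv α.at := by
    filter_upwards [U.isOpen.mem_nhds hx] with y hy using extD_at α hy
  rw [extD_at _ hx, h.extDeriv_eq, extDeriv_extDeriv_apply
    (α.contDiffOn.contDiffAt (U.isOpen.mem_nhds hx))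
    (by rw [minSmoothness_of_isRCLikeNormedField]; exact WithTop.coe_le_coe.2 (le_top : (2 : ℕ∞) ≤ ⊤))]
  rfl

theorem extD_lefForm (α : Form U k) :
    extD U (k + 2) (lefForm U k α) = lefForm U (k + 1) (extD U k α) := by
  refine Form.ext fun x hx => ?_
  rw [lefForm_at, extD_at _ hx, extD_at _ hx]
  exact (extDeriv_map (lef n k) α hx).trans (alternatizeUncurryFin_lef_comp _)

theorem lefForm_injective (hk : k < n) : Function.Injective (lefForm U k) :=
  fun _ _ h => Form.ext fun x _ => lef_injective hk (congrFun (congrArg Form.at h) x)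

/-- `Λ` has constant coefficients, so differentiating `Λα = 0` on the open set `U` gives `Λ(∂ᵥα) =
0`. -/
theorem fderiv_mem_primAlt {α : Form U k} (hα : α ∈ Prim U k) {x : Space n} (hx : x ∈ U)
    (v : Space n) : fderiv ℝ α.at x v ∈ primAlt n k := by
  match k, α, hα with
  | 0, α, hα => trivial
  | 1, α, hα => trivial
  | k + 2, α, hα =>
    have h : HasFDerivAt (fun y => dualLefL n k (α.at y))
        ((dualLefL n k).comp (fderiv ℝ α.at x)) x :=
      (dualLefL n k).hasFDerivAt.comp x (α.differentiableAt hx).hasFDerivAt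
    have h0 : (fun y => dualLefL n k (α.at y)) =ᶠ[nhds x] fun _ => 0 := by
      filter_upwards [U.isOpen.mem_nhds hx] with y hy using hα y hy
    have h1 := h.unique ((hasFDerivAt_const (0 : Alt n k) x).congr_of_eventuallyEq h0)
    exact congrArg (fun T : Space n →L[ℝ] Alt n k => T v) h1

/-- The form `B¹` with `d B - L B¹` primitive, for a primitive form `B`. -/
theorem exists_dPlusGraph (hk : k < n) {α : Form U (k + 1)} (hα : α ∈ Prim U (k + 1)) :
    ∃ β ∈ Prim U k, (α, extD U (k + 1) α - lefForm U k β) ∈ dPlusGraph U (k + 1) := by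
  have hn : (n : ℝ) - k ≠ 0 := sub_ne_zero.2 (by exact_mod_cast hk.ne')
  -- The choice is forced: applying `Λ` to `dα = B⁰ + L B¹` gives `Λdα = ΛL B¹ = (n - k) B¹`.
  let β : Form U k := ((n : ℝ) - k)⁻¹ • (extD U (k + 1) α).map (dualLefL n k)
  have hβx : ∀ x, β.at x = ((n : ℝ) - k)⁻¹ • dualLef n k ((extD U (k + 1) α).at x) :=
    fun _ => rfl
  have hβ : β ∈ Prim U k := fun x hx => by
    rw [hβx, extD_at _ hx]
    exact Submodule.smul_mem _ _
      (dualLef_alternatizeUncurryFin_mem_primAlt (fderiv_mem_primAlt hα hx))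
  refine ⟨β, hβ, hα, fun x hx => ?_, ?_⟩
  · change dualLef n k ((extD U (k + 1) α).at x - lef n k (β.at x)) = 0
    rw [map_sub, dualLef_lef_of_mem_primAlt (hβ x hx), hβx, smul_smul, mul_inv_cancel₀ hn,
      one_smul, sub_self]
  · change extD U (k + 1) α - (extD U (k + 1) α - lefForm U k β) ∈ _
    rw [sub_sub_cancel]
    exact Submodule.mem_map_of_mem hβ

/-- Removing the part `L(Pα)` leaves a primitive form and, by `dL = Ld`, changes `dα` only by an
element of the image of `L`. -/
theorem exists_prim_extD_eq (hk : k < n) (α : Form U (k + 1)) :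
    ∃ β ∈ Prim U (k + 1), ∃ γ : Form U k, extD U (k + 1) α = extD U (k + 1) β + lefForm U k γ := by
  match k, α with
  | 0, α => exact ⟨α, fun _ _ => trivial, 0, by rw [map_zero, add_zero]⟩
  | k + 1, α =>
    obtain ⟨P, hP⟩ := exists_dualLef_sub_lef_eq_zero (n := n) (k := k) (by omega)
    refine ⟨α - lefForm U k (α.map P), fun x _ => hP (α.at x), extD U k (α.map P), ?_⟩
    rw [map_sub, extD_lefForm, sub_add_cancel]

theorem eq_zero_of_lefForm_mem_Prim (hk : k < n) {α : Form U k}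
    (hα : lefForm U k α ∈ Prim U (k + 2)) : α = 0 :=
  Form.ext fun x hx => eq_zero_of_dualLef_lef_eq_zero hk (hα x hx)

theorem mem_closed_iff (α : Form U k) :
    α ∈ closed U k ↔ α ∈ Prim U k ∧ extD U k α ∈ lefPrim U k := by
  change _ ∧ _ ∧ extD U k α - 0 ∈ _ ↔ _
  rw [sub_zero]
  exact ⟨fun h => ⟨h.1, h.2.2⟩, fun h => ⟨h.1, zero_mem _, h.2⟩⟩

/-- Vanishing of the primitive cohomology of the disk in degrees `2 ≤ k < n`. -/
theorem mem_exact_of_mem_closed {c : Space n} (hk : k + 2 < n) {α : Form (disk c) (k + 2)}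
    (hα : α ∈ closed (disk c) (k + 2)) : α ∈ exact (disk c) (k + 2) := by
  obtain ⟨hprim, β, -, hβ⟩ := (mem_closed_iff α).1 hα
  have hdβ : extD (disk c) (k + 1) β = 0 := by
    -- `dβ` has degree `k + 2`, so the hypothesis `k + 2 < n` is exactly what injectivity of `L`
    -- requires.
    apply lefForm_injective hk
    rw [← extD_lefForm, hβ, extD_extD, map_zero]
  -- β has degree `k + 1 > 0`; for a ∂₊-closed 1-form β is a function, and this step fails.
  obtain ⟨γ, rfl⟩ := exists_extD_eq β hdβ
  obtain ⟨δ, hδ⟩ := exists_extD_eq (α - lefForm (disk c) k γ) (by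
    rw [map_sub, extD_lefForm, hβ, sub_self])
  obtain ⟨ε, hε, ζ, hζ⟩ := exists_prim_extD_eq (by omega) δ
  obtain ⟨η, -, hη⟩ := exists_dPlusGraph (by omega : k < n) hε
  have hsub : α - (extD (disk c) (k + 1) ε - lefForm (disk c) k η)
      = lefForm (disk c) k (γ + ζ + η) := by
    rw [sub_eq_iff_eq_add.1 hδ.symm, hζ, map_add, map_add]
    abel
  -- The left side of `hsub` is a difference of primitive forms and the right side is in the image
  -- of `L`.
  have h0 : γ + ζ + η = 0 := eq_zero_of_lefForm_mem_Prim (by omega)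
    (hsub ▸ Submodule.sub_mem _ hprim hη.2.1)
  rw [h0, map_zero, sub_eq_zero] at hsub
  exact ⟨_, hη, hsub.symm⟩

/-! ### Constants, the tautological form and degrees 0 and 1 -/

/-- The alternating form `1` of degree `0`. -/
def oneAlt (n : ℕ) : Alt n 0 := ContinuousAlternatingMap.constOfIsEmpty ℝ (Space n) (Fin 0) 1

theorem oneAlt_apply (v : Fin 0 → Space n) : oneAlt n v = 1 := rfl

theorem eq_smul_oneAlt (A : Alt n 0) : A = A 0 • oneAlt n := by
  ext v
  rw [Subsingleton.elim v 0, ContinuousAlternatingMap.smul_apply, oneAlt_apply, smul_eq_mul,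
    mul_one]

/-- The constant function `1` as a form of degree `0`. -/
def oneForm (U : TopologicalSpace.Opens (Space n)) : Form U 0 :=
  restrictForm U (fun _ => oneAlt n) contDiffOn_const

theorem oneForm_at {x : Space n} (hx : x ∈ U) : (oneForm U).at x = oneAlt n :=
  restrictForm_apply contDiffOn_const hx

theorem extD_oneForm : extD U 0 (oneForm U) = 0 := by
  refine Form.ext fun x hx => ?_
  have h : (oneForm U).at =ᶠ[nhds x] fun _ => oneAlt n := by
    filter_upwards [U.isOpen.mem_nhds hx] with y hy using oneForm_at hy
  rw [extD_at _ hx, h.extDeriv_eq, extDeriv, fderiv_const_apply,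
    ← ContinuousAlternatingMap.alternatizeUncurryFinCLM_apply, map_zero]
  rfl

theorem mem_disk_self (c : Space n) : c ∈ disk c := Metric.mem_ball_self one_pos

theorem oneForm_ne_zero (c : Space n) : oneForm (disk c) ≠ 0 := by
  intro h
  have h1 := congrFun (congrArg Form.at h) c
  rw [oneForm_at (mem_disk_self c)] at h1
  have h2 : oneAlt n 0 = 0 := congrArg (fun A : Alt n 0 => A 0) h1
  rw [oneAlt_apply] at h2
  exact one_ne_zero h2

/-- In degree 0 alternation loses nothing, so `df = 0` forces the whole derivative of `f` to vanish.
-/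
theorem contr_alternatizeUncurryFin_zero (T : Space n →L[ℝ] Alt n 0) (v : Space n) :
    contr v (alternatizeUncurryFin T) = T v := by
  rw [alternatizeUncurryFin_eq_sum, _root_.map_sum, map_eq_sum_ex T v]
  exact Finset.sum_congr rfl fun j _ => contr_wedge_zero _ _ _

theorem exists_eq_smul_oneForm {c : Space n} {f : Form (disk c) 0}
    (hf : extD (disk c) 0 f = 0) : ∃ r : ℝ, f = r • oneForm (disk c) := by
  have hd : ∀ x ∈ disk c, fderiv ℝ f.at x = 0 := fun x hx => by
    have h := extD_at f hx
    rw [hf] at h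
    ext1 v
    rw [← contr_alternatizeUncurryFin_zero]
    exact (congrArg (contr v) h.symm).trans (map_zero _)
  refine ⟨f.at c 0, Form.ext fun x hx => ?_⟩
  have h : f.at x = f.at c :=
    (disk c).isOpen.is_const_of_fderiv_eq_zero (convex_ball c 1).isPreconnected
      (fun y hy => (f.differentiableAt hy).differentiableWithinAt) (fun y hy => hd y hy)
      hx (mem_disk_self c)
  rw [h, Form.at_smul, Pi.smul_apply, oneForm_at hx]
  exact eq_smul_oneAlt _

theorem ofSubsingleton_eq_wedge (f : Space n →L[ℝ] ℝ) :
    ContinuousAlternatingMap.ofSubsingleton ℝ (Space n) ℝ (0 : Fin 1) f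
      = wedge 0 f (oneAlt n) := by
  ext v
  simp [wedge_apply, oneAlt_apply]

theorem extDeriv_tautFun (x : Space n) : extDeriv (tautFun n) x = -lef n 0 (oneAlt n) := by
  have h : HasFDerivAt (tautFun n) (∑ i : Fin n, (dx (Fin.natAdd n i)).smulRight
      (wedge 0 (dx (Fin.castAdd n i)) (oneAlt n))) x := by
    -- θ has coefficients linear in `x`, so `tautFun` is its own derivative.
    refine (ContinuousLinearMap.hasFDerivAt _).congr_of_eventuallyEq (Filter.Eventually.of_forall
      fun y => ?_)
    simp only [tautFun, ofSubsingleton_eq_wedge, _root_.sum_apply,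
      ContinuousLinearMap.smulRight_apply]
    rfl
  rw [extDeriv, h.fderiv, ← ContinuousAlternatingMap.alternatizeUncurryFinCLM_apply,
    _root_.map_sum, lef_apply, ← Finset.sum_neg_distrib]
  exact Finset.sum_congr rfl fun i _ => wedge_wedge_comm _ _ _

theorem extD_taut : extD U 1 (taut U) = -lefForm U 0 (oneForm U) := by
  refine Form.ext fun x hx => ?_
  have h : (taut U).at =ᶠ[nhds x] tautFun n := by
    filter_upwards [U.isOpen.mem_nhds hx] with y hy
      using restrictForm_apply (contDiff_tautFun n).contDiffOn hy
  rw [extD_at _ hx, h.extDeriv_eq, extDeriv_tautFun, ← oneForm_at hx]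
  rfl

theorem taut_mem_closed : taut U ∈ closed U 1 := by
  refine (mem_closed_iff _).2 ⟨fun _ _ => trivial, -oneForm U, fun _ _ => trivial, ?_⟩
  rw [map_neg, extD_taut]

theorem taut_notMem_exact (c : Space n) (hn : 0 < n) : taut (disk c) ∉ exact (disk c) 1 := by
  rintro ⟨⟨f, g⟩, ⟨-, -, h⟩, hg⟩
  -- `lefPrim` is `⊥` in degree 0, so `∂₊f = df`; then `dθ = 0`, against `dθ = -ω` and the
  -- injectivity of `L`.
  have h1 : extD (disk c) 0 f = taut (disk c) := (sub_eq_zero.1 h).trans hg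
  have h2 := extD_taut (U := disk c)
  rw [← h1, extD_extD, eq_comm, neg_eq_zero] at h2
  exact oneForm_ne_zero c (lefForm_injective hn (h2.trans (map_zero _).symm))

theorem extD_mem_exact (f : Form U 0) : extD U 0 f ∈ exact U 1 :=
  ⟨(f, extD U 0 f), ⟨fun _ _ => trivial, fun _ _ => trivial, by simp⟩, rfl⟩

theorem exists_add_smul_taut_mem_exact {c : Space n} (hn : 1 < n) {α : Form (disk c) 1}
    (hα : α ∈ closed (disk c) 1) : ∃ r : ℝ, α - r • taut (disk c) ∈ exact (disk c) 1 := by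
  obtain ⟨-, f, -, hf⟩ := (mem_closed_iff α).1 hα
  have hdf : extD (disk c) 0 f = 0 := by
    apply lefForm_injective hn
    rw [← extD_lefForm, hf, extD_extD, map_zero]
  obtain ⟨r, rfl⟩ := exists_eq_smul_oneForm hdf
  -- Here `dα = rω`, and the sign in `dθ = -ω` makes `-r` the right coefficient.
  obtain ⟨g, hg⟩ := exists_extD_eq (α - (-r) • taut (disk c)) (by
    rw [map_sub, map_smul, extD_taut, ← hf, map_smul, neg_smul_neg, sub_self])
  exact ⟨-r, hg ▸ extD_mem_exact g⟩

theorem oneForm_mem_closed : oneForm U ∈ closed U 0 :=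
  (mem_closed_iff _).2 ⟨fun _ _ => trivial, extD_oneForm⟩

theorem rank_PH_zero (c : Space n) : Module.rank ℝ (PH (disk c) 0) = 1 := by
  refine rank_eq_one_iff.2 ⟨Submodule.Quotient.mk ⟨oneForm (disk c), oneForm_mem_closed⟩, ?_, ?_⟩
  · rw [Ne, Submodule.Quotient.mk_eq_zero]
    exact fun h => oneForm_ne_zero c h
  · intro v
    obtain ⟨⟨α, hα⟩, rfl⟩ := Submodule.Quotient.mk_surjective _ v
    -- Membership in `lefPrim` in degree 0 means being zero, so this is `dα = 0`.
    obtain ⟨r, rfl⟩ := exists_eq_smul_oneForm ((mem_closed_iff α).1 hα).2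
    exact ⟨r, rfl⟩

theorem mk_taut_ne_zero (c : Space n) (hn : 0 < n) :
    (Submodule.Quotient.mk ⟨taut (disk c), taut_mem_closed⟩ : PH (disk c) 1) ≠ 0 := by
  rw [Ne, Submodule.Quotient.mk_eq_zero]
  exact taut_notMem_exact c hn

theorem rank_PH_one (c : Space n) (hn : 1 < n) : Module.rank ℝ (PH (disk c) 1) = 1 := by
  refine rank_eq_one_iff.2 ⟨_, mk_taut_ne_zero c (by omega), fun v => ?_⟩
  obtain ⟨⟨α, hα⟩, rfl⟩ := Submodule.Quotient.mk_surjective _ v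
  obtain ⟨r, hr⟩ := exists_add_smul_taut_mem_exact hn hα
  have h : (Submodule.Quotient.mk ⟨α, hα⟩ : PH (disk c) 1) =
      Submodule.Quotient.mk (r • ⟨taut (disk c), taut_mem_closed⟩) :=
    (Submodule.Quotient.eq (exactInClosed (disk c) 1)).2 hr
  exact ⟨r, h.symm⟩

theorem rank_PH_add_two (c : Space n) (hk : k + 2 < n) :
    Module.rank ℝ (PH (disk c) (k + 2)) = 0 := by
  have h : exactInClosed (disk c) (k + 2) = ⊤ :=
    eq_top_iff.2 fun α _ => mem_exact_of_mem_closed hk α.2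
  have := Submodule.Quotient.subsingleton_iff.2 h
  exact rank_subsingleton' ℝ _

end

end PrimCoh

end

theorem proposition3p11 (n : ℕ) (c : PrimCoh.Space n) :
    (0 < n → Module.rank ℝ (PrimCoh.PH (PrimCoh.disk c) 0) = 1) ∧
    (1 < n → Module.rank ℝ (PrimCoh.PH (PrimCoh.disk c) 1) = 1 ∧
      ∃ h : PrimCoh.taut (PrimCoh.disk c) ∈ PrimCoh.closed (PrimCoh.disk c) 1,
        (Submodule.Quotient.mk ⟨PrimCoh.taut (PrimCoh.disk c), h⟩ :
          PrimCoh.PH (PrimCoh.disk c) 1) ≠ 0) ∧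
    ∀ k : ℕ, 2 ≤ k → k < n → Module.rank ℝ (PrimCoh.PH (PrimCoh.disk c) k) = 0 := by
  refine ⟨fun _ => PrimCoh.rank_PH_zero c, fun hn => ⟨PrimCoh.rank_PH_one c hn,
    PrimCoh.taut_mem_closed, PrimCoh.mk_taut_ne_zero c (by omega)⟩, fun k hk hkn => ?_⟩
  obtain ⟨m, rfl⟩ := Nat.exists_eq_add_of_le' hk
  exact PrimCoh.rank_PH_add_two c hkn
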